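/- Let $p$ be a prime, $n\ge 1$, and let $K/F$ be a Galois extension of fields whose Galois group $G$ is cyclic of order $p^n$. Suppose that $F$ contains a primitive $p$th root of unity $\xi_p$ and, if $p=2$, that $n>1$ or $-1\in N_{K/F}(K^\times)$. For $0\le i\le n$ let $K_i$ be the intermediate field of $K/F$ with $[K_i:F]=p^i$ and let $H_i=\mathrm{Gal}(K/K_i)$; put $K_{-\infty}^\times=\{1\}$ and $N_{K_{n-1}/F}(K_{-\infty}^\times)=\{1\}$. Order $\{-\infty,0,1,\dots,n\}$ in the usual way, and let $-\infty\dotplus 1=0$ and $e\dotplus 1=e+1$ for $e\ge 0$. For a field $L$ and $\gamma\in L^\times$ write $[\gamma]_L$ for the class of $\gamma$ in $L^\times/L^{\times p}$. Let $J=K^\times/K^{\times p}$, a $G$-module, write $[\gamma]=[\gamma]_K$ for the class of $\gamma\in K^\times$ in $J$, and for $i\in\{-\infty,0,\dots,n\}$ let $[K_i^\times]$ be the image of $K_i^\times$ in $J$. Define $i(K/F)$ to be the least $i\in\{-\infty,0,1,\dots,n\}$ for which there is a $\delta\in K^\times$ with $[N_{K/F}(\delta)]_F\ne[1]_F$ and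 $[\delta]^{\tau-1}\in[K_i^\times]$ for all $\tau\in G$. Then this minimum and the three minima below, with $s$ ranging over $\{-\infty,0,1,\dots,n-1\}$, exist, and $$\begin{aligned} i(K/F)&=\min\{s \mid \xi_p\in N_{K/F}(K^\times)\,N_{K_{n-1}/F}(K_s^\times)\}\\ &=\min\{s\mid \xi_p\in N_{K/K_{s\dotplus 1}}(K^\times)\}\\ &=\min\{s\mid \exists\,[\delta]\in J^{H_{s\dotplus 1}},\ [N_{K/K_{s\dotplus 1}}(\delta)]_{K_{s\dotplus 1}}\ne[1]_{K_{s\dotplus 1}}\}.\end{aligned}$$ -/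

import Mathlib

open scoped Pointwise

noncomputable section

/-- The group `J(L) = Lˣ / (Lˣ)ᵖ` of `p`th-power classes of a field `L`. The class `[γ]_L` of a unit
`γ` is written `PowClass.mk p γ`. -/
abbrev PowClass (p : ℕ) (L : Type*) [Field L] : Type _ :=
  Lˣ ⧸ (powMonoidHom p : Lˣ →* Lˣ).range

/-- The class `[γ]_L` of `γ ∈ Lˣ`, as a homomorphism `Lˣ →* J(L)`. -/
def PowClass.mk (p : ℕ) {L : Type*} [Field L] : Lˣ →* PowClass p L :=
  QuotientGroup.mk' _

/-- The homomorphism `J(L) →* J(M)` induced by a homomorphism `Lˣ →* Mˣ`. -/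
def PowClass.map (p : ℕ) {L M : Type*} [Field L] [Field M] (f : Lˣ →* Mˣ) :
    PowClass p L →* PowClass p M :=
  QuotientGroup.map _ _ f (by
    rintro _ ⟨y, rfl⟩
    exact ⟨f y, (map_pow f y p).symm⟩)

/-- The norm `N_{B/A} : Bˣ →* Aˣ`. -/
def unitsNorm (A B : Type*) [Field A] [Field B] [Algebra A B] : Bˣ →* Aˣ :=
  Units.map (Algebra.norm A)

/-- The inclusion `Aˣ →* Bˣ` for a field extension `B/A`. -/
def unitsIncl (A B : Type*) [Field A] [Field B] [Algebra A B] : Aˣ →* Bˣ :=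
  Units.map (algebraMap A B : A →* B)

/-- The action of `τ ∈ Gal(K/F)` on `J(K)`. -/
def PowClass.act (p : ℕ) {F K : Type*} [Field F] [Field K] [Algebra F K] (τ : Gal(K/F)) :
    PowClass p K →* PowClass p K :=
  PowClass.map p (Units.map ((τ : K →ₐ[F] K) : K →* K))

/-- The subgroup `J(K)^H` of classes fixed by a subgroup `H` of `Gal(K/F)`. -/
def PowClass.fixedBy (p : ℕ) {F K : Type*} [Field F] [Field K] [Algebra F K]
    (H : Subgroup Gal(K/F)) : Subgroup (PowClass p K) where
  carrier := {c | ∀ τ ∈ H, PowClass.act p τ c = c}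
  mul_mem' := fun ha hb τ hτ => by rw [map_mul, ha τ hτ, hb τ hτ]
  one_mem' := fun τ _ => map_one _
  inv_mem' := fun ha τ hτ => by rw [map_inv, ha τ hτ]

/-- The intermediate field `K_i`, as the fixed field of the subgroup generated by the
`p ^ i`th powers in `Gal(K/F)`. When `Gal(K/F)` is cyclic of order `p ^ n` and `i ≤ n`, this is the
unique intermediate field of degree `p ^ i` over `F`: see `finrank_layer` and `eq_layer`. -/
def layer (F K : Type*) [Field F] [Field K] [Algebra F K] (p i : ℕ) : IntermediateField F K :=
  IntermediateField.fixedField (Subgroup.closure (Set.range fun τ : Gal(K/F) => τ ^ p ^ i))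

theorem card_closure_pow {G : Type*} [Group G] [IsCyclic G] [Finite G] {p n i : ℕ}
    (hp : p.Prime) (hG : Nat.card G = p ^ n) (hi : i ≤ n) :
    Nat.card (Subgroup.closure (Set.range fun τ : G => τ ^ p ^ i)) = p ^ (n - i) := by
  obtain ⟨g, hg⟩ := IsCyclic.exists_generator (α := G)
  have h1 : Subgroup.closure (Set.range fun τ : G => τ ^ p ^ i) = Subgroup.zpowers (g ^ p ^ i) := by
    apply le_antisymm
    · rw [Subgroup.closure_le]
      rintro _ ⟨τ, rfl⟩
      obtain ⟨k, rfl⟩ := hg τ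
      refine ⟨k, ?_⟩
      simp only [← zpow_natCast, ← zpow_mul]
      rw [mul_comm]
    · rw [Subgroup.zpowers_le]
      exact Subgroup.subset_closure ⟨g, rfl⟩
  rw [h1, Nat.card_zpowers, orderOf_pow, orderOf_eq_card_of_forall_mem_zpowers hg, hG,
    Nat.gcd_eq_right (pow_dvd_pow p hi), Nat.pow_div hi hp.pos]

theorem finrank_layer {F K : Type*} [Field F] [Field K] [Algebra F K] [FiniteDimensional F K]
    [IsGalois F K] [IsCyclic Gal(K/F)] {p n i : ℕ} (hp : p.Prime)
    (hG : Nat.card Gal(K/F) = p ^ n) (hi : i ≤ n) :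
    Module.finrank F (layer F K p i) = p ^ i := by
  have h1 : Module.finrank (layer F K p i) K = p ^ (n - i) := by
    rw [layer, IntermediateField.finrank_fixedField_eq_card, card_closure_pow hp hG hi]
  have h2 := Module.finrank_mul_finrank F (layer F K p i) K
  rw [h1, ← IsGalois.card_aut_eq_finrank F K, hG] at h2
  refine Nat.eq_of_mul_eq_mul_right (pow_pos hp.pos (n - i)) ?_
  rw [h2, ← pow_add, Nat.add_sub_cancel' hi]

theorem eq_layer {F K : Type*} [Field F] [Field K] [Algebra F K] [FiniteDimensional F K]
    [IsGalois F K] [IsCyclic Gal(K/F)] {p n i : ℕ} (hp : p.Prime)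
    (hG : Nat.card Gal(K/F) = p ^ n) (hi : i ≤ n) (E : IntermediateField F K)
    (hE : Module.finrank F E = p ^ i) : E = layer F K p i := by
  have hcard : Nat.card E.fixingSubgroup = p ^ (n - i) := by
    rw [IsGalois.card_fixingSubgroup_eq_finrank]
    have h2 := Module.finrank_mul_finrank F E K
    rw [hE, ← IsGalois.card_aut_eq_finrank F K, hG] at h2
    refine Nat.eq_of_mul_eq_mul_left (pow_pos hp.pos i) ?_
    rw [h2, ← pow_add, Nat.add_sub_cancel' hi]
  have hindex : E.fixingSubgroup.index = p ^ i := by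
    have h2 := E.fixingSubgroup.card_mul_index
    rw [hcard, hG] at h2
    refine Nat.eq_of_mul_eq_mul_left (pow_pos hp.pos (n - i)) ?_
    rw [h2, ← pow_add, Nat.sub_add_cancel hi]
  have hnormal : E.fixingSubgroup.Normal :=
    ⟨fun a ha g => by rwa [IsMulCommutative.is_comm.comm g a, mul_inv_cancel_right]⟩
  have hle : Subgroup.closure (Set.range fun τ : Gal(K/F) => τ ^ p ^ i) ≤ E.fixingSubgroup := by
    rw [Subgroup.closure_le]
    rintro _ ⟨τ, rfl⟩
    have h3 := Subgroup.pow_index_mem E.fixingSubgroup τ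
    rwa [hindex] at h3
  have heq := Subgroup.eq_of_le_of_card_ge hle (by rw [hcard, card_closure_pow hp hG hi])
  rw [layer, heq, IsGalois.fixedField_fixingSubgroup]

/-- The group `K_i^×`, as a subgroup of `Kˣ`, for an index `i` that is either a natural number or
`-∞` (written `⊥`), with the convention `K_{-∞}^× = {1}`. -/
def layerUnits (F K : Type*) [Field F] [Field K] [Algebra F K] (p : ℕ) :
    WithBot ℕ → Subgroup Kˣ
  | ⊥ => ⊥
  | (i : ℕ) => (unitsIncl (layer F K p i) K).range

/-- The subgroup `N_{K_{n-1}/F}(K_s^×)` of `Fˣ`, for `s ∈ {-∞, 0, …, n - 1}`; it is `{1}` for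
`s = -∞`. -/
def normLayerUnits (F K : Type*) [Field F] [Field K] [Algebra F K] (p n : ℕ) (s : WithBot ℕ) :
    Subgroup Fˣ :=
  ((layerUnits F K p s).comap (unitsIncl (layer F K p (n - 1)) K)).map
    (unitsNorm F (layer F K p (n - 1)))

/-- The operation `∔ 1` on indices: `-∞ ∔ 1 = 0` and `e ∔ 1 = e + 1` for `e ≥ 0`. -/
def dotSucc : WithBot ℕ → ℕ
  | ⊥ => 0
  | (e : ℕ) => e + 1

/-- The set of all `i ∈ {-∞, 0, 1, …, n}` for which there is a `δ ∈ Kˣ` with `[N_{K/F}(δ)]_F ≠ [1]_F`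
and `[δ]^(τ - 1) ∈ [K_i^×]` for all `τ ∈ Gal(K/F)`. -/
def exceptionalIndices (F K : Type*) [Field F] [Field K] [Algebra F K] (p n : ℕ) :
    Set (WithBot ℕ) :=
  {i | i ≤ (n : WithBot ℕ) ∧ ∃ δ : Kˣ, PowClass.mk p (unitsNorm F K δ) ≠ 1 ∧
    ∀ τ : Gal(K/F), PowClass.act p τ (PowClass.mk p δ) / PowClass.mk p δ ∈
      (layerUnits F K p i).map (PowClass.mk p)}

/-- The invariant `i(K/F)`: the minimum of `exceptionalIndices F K p n`. -/
def exceptionalInvariant (F K : Type*) [Field F] [Field K] [Algebra F K] (p n : ℕ) : WithBot ℕ :=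
  sInf (exceptionalIndices F K p n)

end

/-! Fix a generator `σ` of the Galois group. For `s < n` write t = s ∔ 1. Each of the four
conditions becomes a statement about products x · σx ⋯ σ^(m-1)x in Kˣ.

The core is `exists_pow_eq_cycNorm`. If σd/d = k^p y with y ∈ K_s, then N_{K/F}(d) = b^p for an
explicit b ∈ Kˣ with σb/b = N_{K/F}(k) · N_{K_{n-1}/F}(y), granted a parity condition. This ratio is
a `p`th root of unity. It is 1 exactly when N_{K/F}(d) is a `p`th power in F (`cycNorm_isPow_iff`).

Call the conditions A (exceptional element), B (ξ in the product of norm groups), C (ξ a norm to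
K_t) and D (fixed class with nontrivial norm to K_t). Then A ⇒ D by restricting to K_t. D ⇒ C by the
criterion over K_t with y = 1. C ⇔ B by transitivity of norms and two uses of Hilbert 90. B ⇒ A by
Hilbert 90 and the criterion over F. Only B ⇒ A needs parity. It is applied only at the least index
satisfying C, where the hypothesis for p = 2 supplies it. -/

/-! ### Cyclic norms and the `p`th-power criterion. -/

section CyclicNorm

variable {G M : Type*} [Monoid G] [CommGroup M] [MulDistribMulAction G M]

/-- The product `x * σ x * ⋯ * σ ^ (m - 1) x`. -/
def cycNorm (σ : G) (m : ℕ) : M →* M where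
  toFun x := ∏ j ∈ Finset.range m, σ ^ j • x
  map_one' := by simp
  map_mul' x y := by simp [Finset.prod_mul_distrib]

theorem cycNorm_apply (σ : G) (m : ℕ) (x : M) :
    cycNorm σ m x = ∏ j ∈ Finset.range m, σ ^ j • x := rfl

@[simp] theorem cycNorm_zero (σ : G) (x : M) : cycNorm σ 0 x = 1 := by simp [cycNorm_apply]

@[simp] theorem cycNorm_one_right (σ : G) (x : M) : cycNorm σ 1 x = x := by simp [cycNorm_apply]

theorem cycNorm_succ (σ : G) (m : ℕ) (x : M) :
    cycNorm σ (m + 1) x = cycNorm σ m x * σ ^ m • x := by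
  simp [cycNorm_apply, Finset.prod_range_succ]

theorem smul_cycNorm_mul (σ : G) (m : ℕ) (x : M) :
    σ • cycNorm σ m x * x = cycNorm σ m x * σ ^ m • x := by
  rw [← cycNorm_succ, cycNorm_apply, cycNorm_apply, Finset.prod_range_succ', Finset.smul_prod']
  simp [pow_succ', mul_smul]

theorem cycNorm_add (σ : G) (a b : ℕ) (x : M) :
    cycNorm σ (a + b) x = cycNorm σ a x * σ ^ a • cycNorm σ b x := by
  simp [cycNorm_apply, Finset.prod_range_add, Finset.smul_prod', pow_add, mul_smul]

theorem cycNorm_pow_smul (σ : G) (a b m : ℕ) (x : M) :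
    cycNorm (σ ^ a) m (σ ^ b • x) = σ ^ b • cycNorm (σ ^ a) m x := by
  simp only [cycNorm_apply, Finset.smul_prod', smul_smul, ← pow_mul, ← pow_add, add_comm]

theorem cycNorm_mul (σ : G) (a b : ℕ) (x : M) :
    cycNorm σ (a * b) x = cycNorm (σ ^ a) b (cycNorm σ a x) := by
  induction b with
  | zero => simp
  | succ b ih => rw [Nat.mul_succ, cycNorm_add, ih, cycNorm_succ, ← pow_mul]

/-- Transitivity of norms in the usual order, the `σ ^ a`-norm being taken first. `cycNorm_mul`
takes it last. The two orders agree because powers of `σ` commute. -/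
theorem cycNorm_mul' (σ : G) (a b : ℕ) (x : M) :
    cycNorm σ (a * b) x = cycNorm σ a (cycNorm (σ ^ a) b x) := by
  rw [cycNorm_mul]
  conv_lhs => rw [cycNorm_apply σ, map_prod]
  simp only [cycNorm_pow_smul]
  rw [← cycNorm_apply]

theorem pow_smul_eq_self {σ : G} {x : M} (h : σ • x = x) (i : ℕ) : σ ^ i • x = x := by
  induction i with
  | zero => simp
  | succ i ih => rw [pow_succ, mul_smul, h, ih]

theorem cycNorm_of_smul_eq {σ : G} {x : M} (h : σ • x = x) (m : ℕ) : cycNorm σ m x = x ^ m := by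
  simp [cycNorm_apply, pow_smul_eq_self h]

theorem smul_cycNorm_of_pow_smul_eq {σ : G} {m : ℕ} {x : M} (h : σ ^ m • x = x) :
    σ • cycNorm σ m x = cycNorm σ m x := by
  have := smul_cycNorm_mul σ m x
  rw [h] at this
  exact mul_right_cancel this

theorem pow_smul_eq_mul_cycNorm {σ : G} {d x : M} (h : σ • d = d * x) (i : ℕ) :
    σ ^ i • d = d * cycNorm σ i x := by
  induction i with
  | zero => simp
  | succ i ih => rw [pow_succ, mul_smul, h, smul_mul', ih, cycNorm_succ, mul_assoc]

theorem smul_prod_cycNorm_mul (σ : G) (q : ℕ) (x : M) :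
    σ • (∏ i ∈ Finset.range q, cycNorm σ i x) * x ^ q =
      (∏ i ∈ Finset.range q, cycNorm σ i x) * cycNorm σ q x := by
  have : x ^ q = ∏ i ∈ Finset.range q, x := by simp
  rw [this, Finset.smul_prod', ← Finset.prod_mul_distrib]
  simp_rw [smul_cycNorm_mul]
  rw [Finset.prod_mul_distrib, ← cycNorm_apply]

/-- With c the norm of length r of y, the norm of length ir + j is c^i times that of length j.
Multiply over i < a and j < r. -/
theorem prod_cycNorm_mul {σ : G} {r : ℕ} {y : M} (hy : σ ^ r • y = y) (a : ℕ) :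
    ∏ i ∈ Finset.range (a * r), cycNorm σ i y =
      cycNorm σ r y ^ (r * ∑ i ∈ Finset.range a, i) *
        (∏ j ∈ Finset.range r, cycNorm σ j y) ^ a := by
  have hc := smul_cycNorm_of_pow_smul_eq hy
  have key (a j : ℕ) : cycNorm σ (a * r + j) y = cycNorm σ r y ^ a * cycNorm σ j y := by
    rw [cycNorm_add, mul_comm a, cycNorm_mul, cycNorm_of_smul_eq (pow_smul_eq_self hc r),
      pow_mul]
    congr 1
    simp only [cycNorm_apply, Finset.smul_prod', smul_smul]
    refine Finset.prod_congr rfl fun i _ => ?_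
    rw [← pow_mul, ← pow_add, add_comm, pow_add, mul_smul, pow_mul, pow_smul_eq_self hy]
  induction a with
  | zero => simp
  | succ a ih =>
    rw [Nat.succ_mul, Finset.prod_range_add, ih, Finset.sum_range_succ, mul_add, pow_add, pow_succ]
    simp_rw [key]
    rw [Finset.prod_mul_distrib, Finset.prod_const, Finset.card_range, ← pow_mul, mul_comm a r]
    simp only [mul_assoc, mul_left_comm, mul_comm]

/-- If `σ d / d = k ^ p * y` with `y` fixed by `σ ^ r`, then the cyclic norm of `d` of length `p * r`
is the `p`th power of an element `b` for which `σ b / b` is a product of cyclic norms of `k`, `y`. -/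
theorem exists_pow_eq_cycNorm {σ : G} {p r : ℕ} {d k y : M} (hd : σ • d = d * (k ^ p * y))
    (hy : σ ^ r • y = y) (hpar : cycNorm σ r y = 1 ∨ 2 ∣ r * (p - 1)) :
    ∃ b : M, b ^ p = cycNorm σ (p * r) d ∧
      σ • b = b * (cycNorm σ (p * r) k * cycNorm σ r y) := by
  have hc := smul_cycNorm_of_pow_smul_eq hy
  set c := cycNorm σ r y with hcdef
  -- The exponent is r · p(p-1)/2, so h = r(p-1)/2 works when r(p-1) is even. This is where parity
  -- enters.
  obtain ⟨h, hh⟩ : ∃ h : ℕ, c ^ (r * ∑ i ∈ Finset.range p, i) = (c ^ h) ^ p := by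
    rcases hpar with h1 | ⟨h, hh⟩
    · exact ⟨0, by simp [h1]⟩
    · refine ⟨h, ?_⟩
      rw [← pow_mul]
      congr 1
      have := Finset.sum_range_id_mul_two p
      have h3 : (r * ∑ i ∈ Finset.range p, i) * 2 = (h * p) * 2 := by
        rw [mul_assoc, this, mul_left_comm, hh]; ring
      omega
  set T := ∏ i ∈ Finset.range (p * r), cycNorm σ i k with hT
  set S := ∏ i ∈ Finset.range r, cycNorm σ i y with hS
  -- Multiplying σ^i d = d · N_i(k)^p · N_i(y) over i < pr gives d^(pr) · T^p · (c^h S)^p. The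
  -- witness is the visible `p`th root.
  refine ⟨d ^ r * T * (c ^ h * S), ?_, ?_⟩
  · rw [cycNorm_apply]
    simp_rw [pow_smul_eq_mul_cycNorm hd, map_mul, map_pow]
    rw [Finset.prod_mul_distrib, Finset.prod_mul_distrib, Finset.prod_pow, prod_cycNorm_mul hy,
      Finset.prod_const, Finset.card_range, hh, ← hT, ← hS]
    simp only [mul_pow, ← pow_mul, mul_assoc, mul_comm p r]
  · have h1 : σ • T = T * cycNorm σ (p * r) k / k ^ (p * r) :=
      eq_div_of_mul_eq' (smul_prod_cycNorm_mul σ (p * r) k)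
    have h2 : σ • S = S * c / y ^ r := eq_div_of_mul_eq' (smul_prod_cycNorm_mul σ r y)
    simp only [smul_mul', smul_pow', hd, h1, h2, hc, mul_pow, ← pow_mul]
    have (a b u v s t w z : M) : a * (u * v) * (b * s / u) * (t * (w * z / v)) =
        a * b * (t * w) * (s * z) := by
      simp only [div_eq_mul_inv]
      rw [← mul_inv_cancel_right (a * b * (t * w) * (s * z)) (u * v)]
      simp only [mul_inv, mul_assoc, mul_left_comm, mul_comm]
    exact this _ _ _ _ _ _ _ _

/-- `p`th roots of unity: every nontrivial one generates all of them. -/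
def PrimeRootsCyclic (M : Type*) [CommGroup M] (p : ℕ) : Prop :=
  ∀ a : M, a ^ p = 1 → a ≠ 1 → ∀ x : M, x ^ p = 1 → ∃ l : ℕ, x = a ^ l

variable {σ : G} {p : ℕ} {ζ : M}

/-- The norm of d is fixed by `σ`, so (σb/b)^p = 1. Any other `p`th root differs from b by a power
of the fixed element `ζ`, so one root is fixed exactly when all are. -/
theorem cycNorm_isPow_iff {r : ℕ} {d k y : M} (hd : σ • d = d * (k ^ p * y))
    (hy : σ ^ r • y = y) (hpar : cycNorm σ r y = 1 ∨ 2 ∣ r * (p - 1))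
    (hσ : ∀ x : M, σ ^ (p * r) • x = x) (hμ : PrimeRootsCyclic M p) (hζ : ζ ^ p = 1)
    (hζ1 : ζ ≠ 1) (hζσ : σ • ζ = ζ) :
    (cycNorm σ (p * r) k * cycNorm σ r y) ^ p = 1 ∧
    ((∃ e : M, σ • e = e ∧ e ^ p = cycNorm σ (p * r) d) ↔
      cycNorm σ (p * r) k * cycNorm σ r y = 1) := by
  obtain ⟨b, hb, hσb⟩ := exists_pow_eq_cycNorm hd hy hpar
  refine ⟨?_, ?_, ?_⟩
  · have h1 := smul_cycNorm_of_pow_smul_eq (hσ d)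
    rw [← hb, smul_pow', hσb, mul_pow] at h1
    exact mul_eq_left.mp h1
  · rintro ⟨e, he, hep⟩
    obtain ⟨l, hl⟩ := hμ ζ hζ hζ1 (b / e) (by rw [div_pow, hb, hep, div_self'])
    rw [div_eq_iff_eq_mul] at hl
    have h2 : σ • b = b := by rw [hl, smul_mul', smul_pow', hζσ, he]
    rw [h2] at hσb
    exact mul_eq_left.mp hσb.symm
  · intro h
    exact ⟨b, by rw [hσb, h, mul_one], hb⟩

/-- The elements of level `s`: only `1` for `s = -∞`, the fixed points of `σ ^ p ^ s` otherwise. -/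
def IsLevel (σ : G) (p : ℕ) : WithBot ℕ → M → Prop
  | ⊥ => fun y => y = 1
  | (i : ℕ) => fun y => σ ^ p ^ i • y = y

theorem pow_smul_eq_of_dvd {a b : ℕ} (h : a ∣ b) {x : M} (hx : σ ^ a • x = x) :
    σ ^ b • x = x := by
  obtain ⟨c, rfl⟩ := h
  rw [pow_mul, pow_smul_eq_self hx]

theorem dotSucc_le {s : WithBot ℕ} {n : ℕ} (hs : s < n) : dotSucc s ≤ n := by
  induction s with
  | bot => exact Nat.zero_le n
  | coe i => exact Nat.succ_le_of_lt (WithBot.coe_lt_coe.mp hs)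

theorem IsLevel.pow_smul_eq {n : ℕ} {s : WithBot ℕ} (hs : s < n) {y : M} (hy : IsLevel σ p s y) :
    σ ^ p ^ (n - 1) • y = y := by
  induction s with
  | bot => rw [show y = 1 from hy, smul_one]
  | coe i =>
    have hi : i < n := WithBot.coe_lt_coe.mp hs
    exact pow_smul_eq_of_dvd (pow_dvd_pow p (by omega)) hy

/-- For s ≥ 0 take v = N_{K_s/F}(y). It is fixed by `σ`, so later norms are mere powers of it. -/
theorem IsLevel.exists_cycNorm_eq_pow {n : ℕ} {s : WithBot ℕ} (hs : s < n) {y : M}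
    (hy : IsLevel σ p s y) :
    ∃ v : M, cycNorm σ (p ^ dotSucc s) y = v ^ p ∧
      cycNorm (σ ^ p ^ dotSucc s) (p ^ (n - dotSucc s)) v = cycNorm σ (p ^ (n - 1)) y := by
  induction s with
  | bot =>
    obtain rfl : y = 1 := hy
    exact ⟨1, by simp, by simp⟩
  | coe i =>
    have hi : i < n := WithBot.coe_lt_coe.mp hs
    have hy' : σ ^ p ^ i • y = y := hy
    have hv := smul_cycNorm_of_pow_smul_eq hy'
    refine ⟨cycNorm σ (p ^ i) y, ?_, ?_⟩
    · change cycNorm σ (p ^ (i + 1)) y = _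
      rw [pow_succ, cycNorm_mul, cycNorm_of_smul_eq (pow_smul_eq_self hv _)]
    · change cycNorm (σ ^ p ^ (i + 1)) (p ^ (n - (i + 1))) _ = _
      have h1 : p ^ (n - 1) = p ^ i * p ^ (n - (i + 1)) := by rw [← pow_add]; congr 1; omega
      rw [h1, cycNorm_mul, cycNorm_of_smul_eq (pow_smul_eq_self hv _),
        cycNorm_of_smul_eq (pow_smul_eq_self hv _)]

/-- Hilbert's Theorem 90 for `σ` and its powers `σ ^ p ^ i`. -/
def HilbertNinety (M : Type*) [CommGroup M] [MulDistribMulAction G M] (σ : G) (p n : ℕ) : Prop :=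
  ∀ i ≤ n, ∀ x : M, cycNorm (σ ^ p ^ i) (p ^ (n - i)) x = 1 → ∃ z : M, σ ^ p ^ i • z = z * x

/-! ### Implications between the four conditions. -/

variable {n : ℕ} {s : WithBot ℕ}

/-- From an exceptional element over the base to one over the layer `s ∔ 1`. -/
theorem exists_fixed_class_of_exceptional (hs : s < n)
    (h : ∃ d k y : M, IsLevel σ p s y ∧ σ • d = d * (k ^ p * y) ∧
      ¬ ∃ e : M, σ • e = e ∧ e ^ p = cycNorm σ (p ^ n) d) :
    ∃ d k : M, σ ^ p ^ dotSucc s • d = d * k ^ p ∧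
      ¬ ∃ e : M, σ ^ p ^ dotSucc s • e = e ∧
        e ^ p = cycNorm (σ ^ p ^ dotSucc s) (p ^ (n - dotSucc s)) d := by
  obtain ⟨d, k, y, hy, hd, hne⟩ := h
  obtain ⟨v, hv, -⟩ := hy.exists_cycNorm_eq_pow hs
  refine ⟨d, cycNorm σ (p ^ dotSucc s) k * v, ?_, ?_⟩
  · rw [pow_smul_eq_mul_cycNorm hd, map_mul, map_pow, hv, mul_pow]
  · rintro ⟨e, he, hep⟩
    refine hne ⟨cycNorm σ (p ^ dotSucc s) e, smul_cycNorm_of_pow_smul_eq he, ?_⟩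
    rw [← map_pow, hep, ← cycNorm_mul', ← pow_add, Nat.add_sub_cancel' (dotSucc_le hs)]

theorem exists_cycNorm_eq_of_fixed_class (hs : s < n)
    (hσ : ∀ x : M, σ ^ p ^ n • x = x) (hμ : PrimeRootsCyclic M p) (hζ : ζ ^ p = 1)
    (hζ1 : ζ ≠ 1) (hζσ : σ • ζ = ζ)
    (h : ∃ d k : M, σ ^ p ^ dotSucc s • d = d * k ^ p ∧
      ¬ ∃ e : M, σ ^ p ^ dotSucc s • e = e ∧
        e ^ p = cycNorm (σ ^ p ^ dotSucc s) (p ^ (n - dotSucc s)) d) :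
    ∃ k : M, cycNorm (σ ^ p ^ dotSucc s) (p ^ (n - dotSucc s)) k = ζ := by
  obtain ⟨d, k, hd, hne⟩ := h
  have hle := dotSucc_le hs
  set t := dotSucc s
  -- For t = n the norm has length 1, and `ζ` is its own norm.
  rcases hle.eq_or_lt with ht | ht
  · exact ⟨ζ, by simp [ht]⟩
  · have hpr : p ^ (n - t) = p * p ^ (n - t - 1) := by
      rw [← pow_succ']; congr 1; omega
    rw [hpr] at hne ⊢
    obtain ⟨h1, h2⟩ := cycNorm_isPow_iff (σ := σ ^ p ^ t) (p := p) (r := p ^ (n - t - 1)) (d := d)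
      (k := k) (y := 1) (by rwa [mul_one]) (smul_one _) (Or.inl (map_one _))
      (fun x => by rw [← hpr, ← pow_mul, ← pow_add, Nat.add_sub_cancel' hle, hσ]) hμ hζ hζ1
      (pow_smul_eq_self hζσ _)
    rw [map_one, mul_one] at h1 h2
    obtain ⟨l, hl⟩ := hμ _ h1 (mt h2.mpr hne) ζ hζ
    exact ⟨k ^ l, by rw [map_pow, ← hl]⟩

/-- Hilbert 90 over K_{i+1} splits k as f ∈ Fˣ times a partial norm of v. Since ζ^p = 1, Hilbert 90
over K_i then makes f a norm from K_i. -/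
theorem mem_norms_of_exists_cycNorm_eq (hs : s < n) (h90 : HilbertNinety M σ p n)
    (hζ : ζ ^ p = 1) (hζσ : σ • ζ = ζ)
    (h : ∃ k : M, cycNorm (σ ^ p ^ dotSucc s) (p ^ (n - dotSucc s)) k = ζ) :
    ∃ k y : M, IsLevel σ p s y ∧ cycNorm σ (p ^ n) k * cycNorm σ (p ^ (n - 1)) y = ζ := by
  obtain ⟨k, hk⟩ := h
  induction s with
  | bot => exact ⟨k, 1, rfl, by simpa [dotSucc] using hk⟩
  | coe i =>
    have hi : i < n := WithBot.coe_lt_coe.mp hs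
    change cycNorm (σ ^ p ^ (i + 1)) (p ^ (n - (i + 1))) k = ζ at hk
    have h1 : cycNorm (σ ^ p ^ (i + 1)) (p ^ (n - (i + 1))) (σ • k / k) = 1 := by
      have := cycNorm_pow_smul σ (p ^ (i + 1)) 1 (p ^ (n - (i + 1))) k
      rw [pow_one] at this
      rw [map_div, this, hk, hζσ, div_self']
    obtain ⟨v, hv⟩ := h90 (i + 1) hi _ h1
    have hf : σ • (k / cycNorm σ (p ^ (i + 1)) v) = k / cycNorm σ (p ^ (i + 1)) v := by
      have h2 := smul_cycNorm_mul σ (p ^ (i + 1)) v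
      rw [hv, mul_left_comm, mul_comm _ v, mul_left_cancel_iff] at h2
      rw [smul_div', h2, ← div_div, div_right_comm, div_div_cancel]
    have hkf := (div_mul_cancel k (cycNorm σ (p ^ (i + 1)) v)).symm
    set f := k / cycNorm σ (p ^ (i + 1)) v
    have hζf : f ^ p ^ (n - (i + 1)) * cycNorm σ (p ^ n) v = ζ := by
      rw [hkf, map_mul, cycNorm_of_smul_eq (pow_smul_eq_self hf _), ← cycNorm_mul, ← pow_add,
        Nat.add_sub_cancel' (Nat.succ_le_of_lt hi)] at hk
      exact hk
    -- The `p`th power of `hζf`: `ζ` disappears.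
    have hfw : f ^ p ^ (n - i) = cycNorm σ (p ^ n) (v⁻¹ ^ p) := by
      have h3 := congrArg (· ^ p) hζf
      simp only [hζ, mul_pow, ← pow_mul, ← pow_succ] at h3
      rw [map_pow, map_inv, inv_pow, ← mul_eq_one_iff_eq_inv, ← h3]
      congr 3
      omega
    set w := v⁻¹ ^ p
    obtain ⟨z, hz⟩ := h90 i hi.le (f / cycNorm σ (p ^ i) w) (by
      rw [map_div, cycNorm_of_smul_eq (pow_smul_eq_self hf _), ← cycNorm_mul, ← pow_add,
        Nat.add_sub_cancel' hi.le, hfw, div_self'])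
    have hfP : cycNorm σ (p ^ i) (w * (σ • z / z)) = f := by
      have h4 := pow_smul_eq_mul_cycNorm (σ := σ) (d := z) (x := σ • z / z) (by simp) (p ^ i)
      rw [hz, mul_left_cancel_iff] at h4
      rw [map_mul, ← h4, mul_div_cancel]
    refine ⟨v, w * (σ • z / z), ?_, ?_⟩
    -- The product of length p^i of y is f, which `σ` fixes. This forces σ^(p^i) y = y, so y has
    -- level i.
    · have h5 := smul_cycNorm_mul σ (p ^ i) (w * (σ • z / z))
      rw [hfP, hf, mul_left_cancel_iff] at h5
      exact h5.symm
    · have h6 : p ^ (n - 1) = p ^ i * p ^ (n - (i + 1)) := by rw [← pow_add]; congr 1; omega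
      rw [h6, cycNorm_mul, hfP, cycNorm_of_smul_eq (pow_smul_eq_self hf _), mul_comm, hζf]

theorem exists_cycNorm_eq_of_mem_norms (hs : s < n)
    (h : ∃ k y : M, IsLevel σ p s y ∧
      cycNorm σ (p ^ n) k * cycNorm σ (p ^ (n - 1)) y = ζ) :
    ∃ k : M, cycNorm (σ ^ p ^ dotSucc s) (p ^ (n - dotSucc s)) k = ζ := by
  obtain ⟨k, y, hy, hk⟩ := h
  obtain ⟨v, -, hv⟩ := hy.exists_cycNorm_eq_pow hs
  refine ⟨cycNorm σ (p ^ dotSucc s) k * v, ?_⟩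
  rw [map_mul, hv, ← cycNorm_mul, ← pow_add, Nat.add_sub_cancel' (dotSucc_le hs), hk]

/-- The norm of k^p y is ζ^p = 1, so Hilbert 90 provides d. Its obstruction in the criterion is `ζ`
≠ 1. -/
theorem exceptional_of_mem_norms (hn : 1 ≤ n) (hs : s < n) (h90 : HilbertNinety M σ p n)
    (hσ : ∀ x : M, σ ^ p ^ n • x = x) (hμ : PrimeRootsCyclic M p) (hζ : ζ ^ p = 1)
    (hζ1 : ζ ≠ 1) (hζσ : σ • ζ = ζ) (hpar : s = ⊥ ∨ 2 ∣ p ^ (n - 1) * (p - 1))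
    (h : ∃ k y : M, IsLevel σ p s y ∧
      cycNorm σ (p ^ n) k * cycNorm σ (p ^ (n - 1)) y = ζ) :
    ∃ d k y : M, IsLevel σ p s y ∧ σ • d = d * (k ^ p * y) ∧
      ¬ ∃ e : M, σ • e = e ∧ e ^ p = cycNorm σ (p ^ n) d := by
  obtain ⟨k, y, hy, hk⟩ := h
  have hfix := hy.pow_smul_eq hs
  have hpn : p ^ n = p * p ^ (n - 1) := by rw [← pow_succ']; congr 1; omega
  have h1 : cycNorm σ (p ^ n) (k ^ p * y) = 1 := by
    rw [map_mul, map_pow]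
    nth_rw 2 [hpn]
    rw [mul_comm p, cycNorm_mul,
      cycNorm_of_smul_eq (pow_smul_eq_self (smul_cycNorm_of_pow_smul_eq hfix) _), ← mul_pow, hk, hζ]
  obtain ⟨d, hd⟩ := h90 0 (Nat.zero_le n) (k ^ p * y) (by rwa [pow_zero, pow_one, Nat.sub_zero])
  rw [pow_zero, pow_one] at hd
  refine ⟨d, k, y, hy, hd, ?_⟩
  have h2 := (cycNorm_isPow_iff hd hfix (hpar.imp (fun h => by
    subst h; rw [show y = 1 from hy, map_one]) id) (by rwa [← hpn]) hμ hζ hζ1 hζσ).2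
  rw [← hpn, hk] at h2
  exact mt h2.mp hζ1

end CyclicNorm

/-! ### Field norms, Hilbert 90 and roots of unity in a cyclic extension. -/

section CyclicExtension

theorem cycNorm_congr {G G' M : Type*} [Monoid G] [Monoid G'] [CommGroup M]
    [MulDistribMulAction G M] [MulDistribMulAction G' M] {σ : G} {τ : G'}
    (h : ∀ x : M, σ • x = τ • x) (m : ℕ) (x : M) : cycNorm σ m x = cycNorm τ m x := by
  have key (j : ℕ) : σ ^ j • x = τ ^ j • x := by
    induction j with
    | zero => simp
    | succ j ih => rw [pow_succ', pow_succ', mul_smul, mul_smul, ih, h]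
  simp only [cycNorm_apply, key]

variable {E L : Type*} [Field E] [Field L] [Algebra E L]

theorem unitsIncl_injective : Function.Injective (unitsIncl E L) :=
  Units.map_injective (algebraMap E L).injective

variable [FiniteDimensional E L]

theorem exists_smul_eq_mul_of_cycNorm_eq_one {τ : Gal(L/E)}
    (hτ : ∀ g, g ∈ Subgroup.zpowers τ) {x : Lˣ} (hx : cycNorm τ (Nat.card Gal(L/E)) x = 1) :
    ∃ z : Lˣ, τ • z = z * x := by
  set m := Nat.card Gal(L/E) with hm
  have hord : orderOf τ = m := orderOf_eq_card_of_forall_mem_zpowers hτ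
  have hpow (g : Gal(L/E)) : ∃ j : ℕ, τ ^ j = g :=
    mem_powers_iff_mem_zpowers.mpr (hτ g)
  choose e he using hpow
  have hstep (a : ℕ) : cycNorm τ (a + m) x = cycNorm τ a x := by
    rw [cycNorm_add, hx, smul_one, mul_one]
  have hper : Function.Periodic (fun a => cycNorm τ a x) m := hstep
  have hcong {a b : ℕ} (h : τ ^ a = τ ^ b) : cycNorm τ a x = cycNorm τ b x := by
    have h1 : a % m = b % m := by rw [← hord]; exact pow_inj_mod.mp h
    have h2 : cycNorm τ (a % m) x = cycNorm τ a x := hper.map_mod_nat a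
    have h3 : cycNorm τ (b % m) x = cycNorm τ b x := hper.map_mod_nat b
    rw [← h2, ← h3, h1]
  -- Noether's form applies to the cocycle τ^a ↦ N_a(x), well defined because N_a(x) depends only on
  -- a mod m.
  obtain ⟨z, hz⟩ := groupCohomology.isMulCoboundary₁_of_isMulCocycle₁_of_aut_to_units
    (fun g : Gal(L/E) => cycNorm τ (e g) x) (fun g h => by
      have : cycNorm τ (e (g * h)) x = cycNorm τ (e g + e h) x :=
        hcong (by rw [pow_add, he, he, he])
      change cycNorm τ (e (g * h)) x = g • cycNorm τ (e h) x * cycNorm τ (e g) x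
      rw [this, cycNorm_add, he, mul_comm])
  refine ⟨z, ?_⟩
  have h1 := hz τ
  have h2 : cycNorm τ (e τ) x = cycNorm τ 1 x := hcong (by rw [he, pow_one])
  simp only [h2, cycNorm_one_right] at h1
  rw [← h1, mul_div_cancel]

variable [IsGalois E L]

theorem unitsIncl_unitsNorm {τ : Gal(L/E)} (hτ : ∀ g, g ∈ Subgroup.zpowers τ) (x : Lˣ) :
    unitsIncl E L (unitsNorm E L x) = cycNorm τ (Nat.card Gal(L/E)) x := by
  classical
  ext
  change algebraMap E L (Algebra.norm E (x : L)) = _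
  have hord : orderOf τ = Nat.card Gal(L/E) := orderOf_eq_card_of_forall_mem_zpowers hτ
  rw [Algebra.norm_eq_prod_automorphisms, ← IsCyclic.image_range_card hτ, Finset.prod_image,
    cycNorm_apply, Units.coe_prod]
  · rfl
  · intro a ha b hb hab
    refine pow_injOn_Iio_orderOf (x := τ) ?_ ?_ hab
    · simpa [hord] using ha
    · simpa [hord] using hb

theorem mem_range_unitsIncl_iff {τ : Gal(L/E)} (hτ : ∀ g, g ∈ Subgroup.zpowers τ) (x : Lˣ) :
    x ∈ (unitsIncl E L).range ↔ τ • x = x := by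
  constructor
  · rintro ⟨y, rfl⟩
    ext
    exact τ.commutes y
  · intro h
    have hfix : ∀ g : Gal(L/E), g x = (x : L) := by
      intro g
      obtain ⟨j, rfl⟩ : ∃ j : ℕ, τ ^ j = g := mem_powers_iff_mem_zpowers.mpr (hτ g)
      exact congrArg Units.val (pow_smul_eq_self h j)
    obtain ⟨y, hy⟩ := (IsGalois.mem_range_algebraMap_iff_fixed (x : L)).mpr hfix
    have hy0 : y ≠ 0 := by
      rintro rfl
      exact x.ne_zero (by rw [← hy, map_zero])
    exact ⟨Units.mk0 y hy0, Units.ext hy⟩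

theorem PowClass.mk_eq_one_iff {p : ℕ} (x : Eˣ) : PowClass.mk p x = 1 ↔ ∃ y : Eˣ, y ^ p = x :=
  QuotientGroup.eq_one_iff x

theorem PowClass.mk_unitsNorm_eq_one_iff {τ : Gal(L/E)} (hτ : ∀ g, g ∈ Subgroup.zpowers τ)
    (p : ℕ) (x : Lˣ) : PowClass.mk p (unitsNorm E L x) = 1 ↔
      ∃ e : Lˣ, τ • e = e ∧ e ^ p = cycNorm τ (Nat.card Gal(L/E)) x := by
  rw [PowClass.mk_eq_one_iff, ← unitsIncl_unitsNorm hτ]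
  constructor
  · rintro ⟨y, hy⟩
    exact ⟨unitsIncl E L y, (mem_range_unitsIncl_iff hτ _).mp ⟨y, rfl⟩, by rw [← map_pow, hy]⟩
  · rintro ⟨e, he, hep⟩
    obtain ⟨y, rfl⟩ := (mem_range_unitsIncl_iff hτ _).mpr he
    exact ⟨y, unitsIncl_injective (by rw [map_pow, hep])⟩

omit [FiniteDimensional E L] [IsGalois E L] in
theorem primeRootsCyclic_units {p : ℕ} (hp : p.Prime) : PrimeRootsCyclic Lˣ p := by
  intro a ha ha1 x hx
  have : Fact p.Prime := ⟨hp⟩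
  have hprim : IsPrimitiveRoot a p := IsPrimitiveRoot.iff_orderOf.mpr (orderOf_eq_prime ha ha1)
  obtain ⟨l, -, hl⟩ := (IsPrimitiveRoot.coe_units_iff.mpr hprim).eq_pow_of_pow_eq_one
    (ξ := (x : L)) (by rw [← Units.val_pow_eq_pow_val, hx, Units.val_one])
  exact ⟨l, Units.ext (by rw [Units.val_pow_eq_pow_val, hl])⟩

end CyclicExtension

/-! ### The layers K_i and the generators `σ ^ p ^ i` of their Galois groups. -/

section Layers

variable {F K : Type*} [Field F] [Field K] [Algebra F K] [FiniteDimensional F K] [IsGalois F K]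
  {p n : ℕ} {σ : Gal(K/F)}

omit [IsGalois F K] in
theorem mem_fixingSubgroup_layer_iff (hσ : ∀ g, g ∈ Subgroup.zpowers σ) (i : ℕ) (τ : Gal(K/F)) :
    τ ∈ (layer F K p i).fixingSubgroup ↔ τ ∈ Subgroup.zpowers (σ ^ p ^ i) := by
  rw [layer, IntermediateField.fixingSubgroup_fixedField]
  suffices Subgroup.closure (Set.range fun τ : Gal(K/F) => τ ^ p ^ i) =
      Subgroup.zpowers (σ ^ p ^ i) by rw [this]
  apply le_antisymm
  · rw [Subgroup.closure_le]
    rintro _ ⟨g, rfl⟩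
    obtain ⟨k, rfl⟩ := hσ g
    refine ⟨k, ?_⟩
    simp only [← zpow_natCast, ← zpow_mul]
    rw [mul_comm]
  · rw [Subgroup.zpowers_le]
    exact Subgroup.subset_closure ⟨σ, rfl⟩

omit [IsGalois F K] in
theorem exists_generator_layer (hσ : ∀ g, g ∈ Subgroup.zpowers σ) (i : ℕ) :
    ∃ τ : Gal(K/(layer F K p i)), (∀ g, g ∈ Subgroup.zpowers τ) ∧
      ∀ x : Kˣ, τ • x = σ ^ p ^ i • x := by
  have hmem := (mem_fixingSubgroup_layer_iff (p := p) hσ i (σ ^ p ^ i)).mpr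
    (Subgroup.mem_zpowers _)
  refine ⟨IntermediateField.fixingSubgroupEquiv _ ⟨σ ^ p ^ i, hmem⟩, fun g => ?_, fun x => rfl⟩
  obtain ⟨h, rfl⟩ := (IntermediateField.fixingSubgroupEquiv (layer F K p i)).surjective g
  obtain ⟨k, hk⟩ := (mem_fixingSubgroup_layer_iff hσ i h).mp h.2
  refine ⟨k, ?_⟩
  change IntermediateField.fixingSubgroupEquiv _ _ ^ k = _
  rw [← map_zpow]
  congr 1
  exact Subtype.ext hk

theorem mem_range_unitsIncl_layer_iff (hσ : ∀ g, g ∈ Subgroup.zpowers σ) (i : ℕ) (x : Kˣ) :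
    x ∈ (unitsIncl (layer F K p i) K).range ↔ σ ^ p ^ i • x = x := by
  obtain ⟨τ, hτ, h⟩ := exists_generator_layer (p := p) hσ i
  rw [mem_range_unitsIncl_iff hτ, h]

theorem mem_layerUnits_iff (hσ : ∀ g, g ∈ Subgroup.zpowers σ) (s : WithBot ℕ) (x : Kˣ) :
    x ∈ layerUnits F K p s ↔ IsLevel σ p s x := by
  induction s with
  | bot => exact Subgroup.mem_bot
  | coe i => exact mem_range_unitsIncl_layer_iff hσ i x

variable [IsCyclic Gal(K/F)]

theorem card_gal_layer (hp : p.Prime) (hG : Nat.card Gal(K/F) = p ^ n) {i : ℕ} (hi : i ≤ n) :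
    Nat.card Gal(K/(layer F K p i)) = p ^ (n - i) := by
  rw [IsGalois.card_aut_eq_finrank, layer, IntermediateField.finrank_fixedField_eq_card,
    card_closure_pow hp hG hi]

theorem unitsIncl_unitsNorm_layer (hσ : ∀ g, g ∈ Subgroup.zpowers σ) (hp : p.Prime)
    (hG : Nat.card Gal(K/F) = p ^ n) {i : ℕ} (hi : i ≤ n) (x : Kˣ) :
    unitsIncl (layer F K p i) K (unitsNorm (layer F K p i) K x) =
      cycNorm (σ ^ p ^ i) (p ^ (n - i)) x := by
  obtain ⟨τ, hτ, h⟩ := exists_generator_layer (p := p) hσ i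
  rw [unitsIncl_unitsNorm hτ, card_gal_layer hp hG hi, cycNorm_congr h]

theorem PowClass.mk_unitsNorm_layer_eq_one_iff (hσ : ∀ g, g ∈ Subgroup.zpowers σ) (hp : p.Prime)
    (hG : Nat.card Gal(K/F) = p ^ n) {i : ℕ} (hi : i ≤ n) (x : Kˣ) :
    PowClass.mk p (unitsNorm (layer F K p i) K x) = 1 ↔
      ∃ e : Kˣ, σ ^ p ^ i • e = e ∧ e ^ p = cycNorm (σ ^ p ^ i) (p ^ (n - i)) x := by
  obtain ⟨τ, hτ, h⟩ := exists_generator_layer (p := p) hσ i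
  simp_rw [PowClass.mk_unitsNorm_eq_one_iff hτ, card_gal_layer hp hG hi, cycNorm_congr h, h]

theorem hilbertNinety (hσ : ∀ g, g ∈ Subgroup.zpowers σ) (hp : p.Prime)
    (hG : Nat.card Gal(K/F) = p ^ n) : HilbertNinety Kˣ σ p n := by
  intro i hi x hx
  obtain ⟨τ, hτ, h⟩ := exists_generator_layer (p := p) hσ i
  simp_rw [← h]
  apply exists_smul_eq_mul_of_cycNorm_eq_one hτ
  rw [card_gal_layer hp hG hi, cycNorm_congr h, hx]

/-- The norm of an intermediate layer over the base field, as a cyclic norm. -/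
theorem unitsIncl_unitsNorm_of_layer (hσ : ∀ g, g ∈ Subgroup.zpowers σ) (hp : p.Prime)
    (hG : Nat.card Gal(K/F) = p ^ n) {i : ℕ} (hi : i ≤ n) (y : (layer F K p i)ˣ) :
    unitsIncl F K (unitsNorm F (layer F K p i) y) =
      cycNorm σ (p ^ i) (unitsIncl (layer F K p i) K y) := by
  have : IsAbelianGalois F K := .of_isCyclic F K
  have hτ : ∀ g, g ∈ Subgroup.zpowers (AlgEquiv.restrictNormalHom (layer F K p i) σ) := by
    intro g
    obtain ⟨g, rfl⟩ := AlgEquiv.restrictNormalHom_surjective K g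
    obtain ⟨k, rfl⟩ := hσ g
    exact ⟨k, by simp⟩
  have h1 := congrArg (unitsIncl (layer F K p i) K) (unitsIncl_unitsNorm hτ y)
  rw [IsGalois.card_aut_eq_finrank, finrank_layer hp hG hi] at h1
  have h2 (z : Fˣ) : unitsIncl (layer F K p i) K (unitsIncl F (layer F K p i) z) =
      unitsIncl F K z := Units.ext (IsScalarTower.algebraMap_apply F (layer F K p i) K (z : F)).symm
  rw [← h2, h1, cycNorm_apply, cycNorm_apply, map_prod]
  refine Finset.prod_congr rfl fun j _ => ?_
  rw [← map_pow]
  ext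
  exact AlgEquiv.restrictNormalHom_apply (layer F K p i) (σ ^ j) (y : layer F K p i)

end Layers

/-! ### Translation of the four conditions into cyclic norms. -/

section Reformulation

variable {F K : Type*} [Field F] [Field K] [Algebra F K]

theorem PowClass.mk_surjective (p : ℕ) : Function.Surjective (PowClass.mk p : Kˣ →* _) :=
  QuotientGroup.mk'_surjective _

theorem PowClass.mk_div (p : ℕ) (x y : Kˣ) :
    PowClass.mk p (x / y) = PowClass.mk p x / PowClass.mk p y := rfl

theorem PowClass.mk_eq_mk_iff {p : ℕ} {x y : Kˣ} :
    PowClass.mk p x = PowClass.mk p y ↔ ∃ k : Kˣ, x = y * k ^ p := by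
  rw [← div_eq_one, ← PowClass.mk_div, PowClass.mk_eq_one_iff]
  exact exists_congr fun k => by rw [eq_comm, div_eq_iff_eq_mul']

theorem PowClass.act_mk (p : ℕ) (τ : Gal(K/F)) (x : Kˣ) :
    PowClass.act p τ (PowClass.mk p x) = PowClass.mk p (τ • x) := rfl

theorem IsLevel.cycNorm {p : ℕ} {σ : Gal(K/F)} {s : WithBot ℕ} {y : Kˣ} (hy : IsLevel σ p s y)
    (j : ℕ) : IsLevel σ p s (cycNorm σ j y) := by
  induction s with
  | bot => rw [show y = 1 from hy, map_one]; rfl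
  | coe i =>
    have h := cycNorm_pow_smul σ 1 (p ^ i) j y
    rw [pow_one, show σ ^ p ^ i • y = y from hy] at h
    exact h.symm

variable [FiniteDimensional F K] [IsGalois F K] {p n : ℕ} {σ : Gal(K/F)} {s : WithBot ℕ}

/-- Testing τ = σ suffices: σ^j d = d · N_j(k)^p · N_j(y), and N_j(y) stays in K_s. -/
theorem mem_exceptionalIndices_iff (hσ : ∀ g, g ∈ Subgroup.zpowers σ)
    (hG : Nat.card Gal(K/F) = p ^ n) : s ∈ exceptionalIndices F K p n ↔
      s ≤ n ∧ ∃ d k y : Kˣ, IsLevel σ p s y ∧ σ • d = d * (k ^ p * y) ∧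
        ¬ ∃ e : Kˣ, σ • e = e ∧ e ^ p = cycNorm σ (p ^ n) d := by
  refine and_congr_right fun _ => ⟨?_, ?_⟩
  · rintro ⟨d, hd, hact⟩
    obtain ⟨y, hy, hyd⟩ := hact σ
    rw [PowClass.act_mk, ← PowClass.mk_div] at hyd
    obtain ⟨k, hk⟩ := PowClass.mk_eq_mk_iff.mp hyd.symm
    refine ⟨d, k, y, (mem_layerUnits_iff hσ s y).mp hy, ?_, ?_⟩
    · rw [mul_comm (k ^ p), ← hk, mul_div_cancel]
    · rwa [← hG, ← PowClass.mk_unitsNorm_eq_one_iff hσ]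
  · rintro ⟨d, k, y, hy, hd, hne⟩
    refine ⟨d, by rwa [Ne, PowClass.mk_unitsNorm_eq_one_iff hσ, hG], fun τ => ?_⟩
    obtain ⟨j, rfl⟩ : ∃ j : ℕ, σ ^ j = τ := mem_powers_iff_mem_zpowers.mpr (hσ τ)
    refine ⟨cycNorm σ j y, (mem_layerUnits_iff hσ s _).mpr (hy.cycNorm j), ?_⟩
    rw [PowClass.act_mk, ← PowClass.mk_div, pow_smul_eq_mul_cycNorm hd, mul_div_cancel_left, map_mul,
      map_pow]
    exact PowClass.mk_eq_mk_iff.mpr ⟨(cycNorm σ j k)⁻¹, by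
      rw [inv_pow, mul_right_comm, mul_inv_cancel, one_mul]⟩

variable [IsCyclic Gal(K/F)]

theorem mem_norm_mul_normLayerUnits_iff (hσ : ∀ g, g ∈ Subgroup.zpowers σ) (hp : p.Prime)
    (hG : Nat.card Gal(K/F) = p ^ n) (hs : s < n) (ξ : Fˣ) :
    ξ ∈ ((unitsNorm F K).range : Set Fˣ) * (normLayerUnits F K p n s : Set Fˣ) ↔
      ∃ k y : Kˣ, IsLevel σ p s y ∧
        cycNorm σ (p ^ n) k * cycNorm σ (p ^ (n - 1)) y = unitsIncl F K ξ := by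
  constructor
  · rintro ⟨_, ⟨k, rfl⟩, _, ⟨y, hy, rfl⟩, rfl⟩
    refine ⟨k, unitsIncl _ K y, (mem_layerUnits_iff hσ s _).mp hy, ?_⟩
    simp only [map_mul]
    rw [unitsIncl_unitsNorm hσ, hG, unitsIncl_unitsNorm_of_layer hσ hp hG (Nat.sub_le n 1)]
  · rintro ⟨k, y, hy, h⟩
    obtain ⟨y, rfl⟩ := (mem_range_unitsIncl_layer_iff hσ (n - 1) y).mpr (hy.pow_smul_eq hs)
    refine ⟨_, ⟨k, rfl⟩, _, ⟨y, (mem_layerUnits_iff hσ s _).mpr hy, rfl⟩, unitsIncl_injective (L := K) ?_⟩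
    simp only [map_mul]
    rw [unitsIncl_unitsNorm hσ, hG, unitsIncl_unitsNorm_of_layer hσ hp hG (Nat.sub_le n 1), h]

theorem mem_range_unitsNorm_layer_iff (hσ : ∀ g, g ∈ Subgroup.zpowers σ) (hp : p.Prime)
    (hG : Nat.card Gal(K/F) = p ^ n) {i : ℕ} (hi : i ≤ n) (ξ : Fˣ) :
    unitsIncl F (layer F K p i) ξ ∈ (unitsNorm (layer F K p i) K).range ↔
      ∃ k : Kˣ, cycNorm (σ ^ p ^ i) (p ^ (n - i)) k = unitsIncl F K ξ := by
  refine exists_congr fun k => ?_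
  rw [← unitsIncl_unitsNorm_layer hσ hp hG hi]
  exact (unitsIncl_injective (E := layer F K p i) (L := K)).eq_iff.symm

theorem exists_mem_fixedBy_iff (hσ : ∀ g, g ∈ Subgroup.zpowers σ) (hp : p.Prime)
    (hG : Nat.card Gal(K/F) = p ^ n) {i : ℕ} (hi : i ≤ n) :
    (∃ c ∈ PowClass.fixedBy p (layer F K p i).fixingSubgroup,
      PowClass.map p (unitsNorm (layer F K p i) K) c ≠ 1) ↔
      ∃ d k : Kˣ, σ ^ p ^ i • d = d * k ^ p ∧
        ¬ ∃ e : Kˣ, σ ^ p ^ i • e = e ∧ e ^ p = cycNorm (σ ^ p ^ i) (p ^ (n - i)) d := by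
  have hmap (d : Kˣ) : PowClass.map p (unitsNorm (layer F K p i) K) (PowClass.mk p d) =
      PowClass.mk p (unitsNorm (layer F K p i) K d) := rfl
  constructor
  · rintro ⟨c, hc, hne⟩
    obtain ⟨d, rfl⟩ := PowClass.mk_surjective p c
    obtain ⟨k, hk⟩ := PowClass.mk_eq_mk_iff.mp (hc (σ ^ p ^ i)
      ((mem_fixingSubgroup_layer_iff hσ i _).mpr (Subgroup.mem_zpowers _)))
    exact ⟨d, k, hk, by rwa [← PowClass.mk_unitsNorm_layer_eq_one_iff hσ hp hG hi, ← hmap]⟩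
  · rintro ⟨d, k, hk, hne⟩
    refine ⟨PowClass.mk p d, fun τ hτ => ?_, ?_⟩
    · obtain ⟨j, rfl⟩ : ∃ j : ℕ, (σ ^ p ^ i) ^ j = τ :=
        mem_powers_iff_mem_zpowers.mpr ((mem_fixingSubgroup_layer_iff hσ i τ).mp hτ)
      rw [PowClass.act_mk]
      exact PowClass.mk_eq_mk_iff.mpr ⟨cycNorm (σ ^ p ^ i) j k, by
        rw [pow_smul_eq_mul_cycNorm hk, map_pow]⟩
    · rwa [hmap, Ne, PowClass.mk_unitsNorm_layer_eq_one_iff hσ hp hG hi]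

end Reformulation

theorem theorem3 {F K : Type*} [Field F] [Field K] [Algebra F K]
    [FiniteDimensional F K] [IsGalois F K] [IsCyclic Gal(K/F)]
    (p n : ℕ) (hp : p.Prime) (hn : 1 ≤ n) (hG : Nat.card Gal(K/F) = p ^ n)
    (ξ : Fˣ) (hξ : IsPrimitiveRoot (ξ : F) p)
    (h2 : p = 2 → 1 < n ∨ (-1 : Fˣ) ∈ (unitsNorm F K).range) :
    IsLeast (exceptionalIndices F K p n) (exceptionalInvariant F K p n) ∧
    IsLeast {s : WithBot ℕ | s < (n : WithBot ℕ) ∧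
        ξ ∈ ((unitsNorm F K).range : Set Fˣ) * (normLayerUnits F K p n s : Set Fˣ)}
      (exceptionalInvariant F K p n) ∧
    IsLeast {s : WithBot ℕ | s < (n : WithBot ℕ) ∧
        unitsIncl F (layer F K p (dotSucc s)) ξ ∈ (unitsNorm (layer F K p (dotSucc s)) K).range}
      (exceptionalInvariant F K p n) ∧
    IsLeast {s : WithBot ℕ | s < (n : WithBot ℕ) ∧
        ∃ c ∈ PowClass.fixedBy p (layer F K p (dotSucc s)).fixingSubgroup,
          PowClass.map p (unitsNorm (layer F K p (dotSucc s)) K) c ≠ 1}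
      (exceptionalInvariant F K p n) := by
  obtain ⟨σ, hσ⟩ := IsCyclic.exists_generator (α := Gal(K/F))
  have hξu : IsPrimitiveRoot ξ p := IsPrimitiveRoot.coe_units_iff.mp hξ
  have hζp : unitsIncl F K ξ ^ p = 1 := by rw [← map_pow, hξu.pow_eq_one, map_one]
  have hζ1 : unitsIncl F K ξ ≠ 1 := by
    rw [Ne, map_eq_one_iff _ unitsIncl_injective]
    exact hξu.ne_one hp.one_lt
  have hζσ : σ • unitsIncl F K ξ = unitsIncl F K ξ :=
    (mem_range_unitsIncl_iff hσ _).mp ⟨ξ, rfl⟩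
  have h90 := hilbertNinety hσ hp hG
  have hμ : PrimeRootsCyclic Kˣ p := primeRootsCyclic_units hp
  have hpow (x : Kˣ) : σ ^ p ^ n • x = x := by
    rw [← hG, pow_card_eq_one', one_smul]
  have hB (s : WithBot ℕ) (hs : s < n) := mem_norm_mul_normLayerUnits_iff hσ hp hG hs ξ
  have hC (s : WithBot ℕ) (hs : s < n) :=
    mem_range_unitsNorm_layer_iff hσ hp hG (dotSucc_le hs) ξ
  have hD (s : WithBot ℕ) (hs : s < n) := exists_mem_fixedBy_iff hσ hp hG (dotSucc_le hs)
  -- the least index for which `ξ` is a norm from `K` to the next layer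
  obtain ⟨m, hm, hmin⟩ := wellFounded_lt.has_min
    {s : WithBot ℕ | s < n ∧ ∃ k : Kˣ,
      cycNorm (σ ^ p ^ dotSucc s) (p ^ (n - dotSucc s)) k = unitsIncl F K ξ}
    ⟨((n - 1 : ℕ) : WithBot ℕ), WithBot.coe_lt_coe.mpr (Nat.sub_lt hn one_pos), unitsIncl F K ξ, by
      have : n - dotSucc ((n - 1 : ℕ) : WithBot ℕ) = 0 := by
        change n - (n - 1 + 1) = 0
        omega
      rw [this, pow_zero, cycNorm_one_right]⟩
  obtain ⟨hmn, hmC⟩ := hm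
  have hle (s : WithBot ℕ) (hs : s < n) (h : ∃ k : Kˣ,
      cycNorm (σ ^ p ^ dotSucc s) (p ^ (n - dotSucc s)) k = unitsIncl F K ξ) : m ≤ s :=
    not_lt.mp (hmin s ⟨hs, h⟩)
  have hmB := mem_norms_of_exists_cycNorm_eq hmn h90 hζp hζσ hmC
  -- Parity can fail only for p = 2, n = 1. Then ξ = -1 is a norm from K to F, and minimality gives
  -- m = -∞.
  have hpar : m = ⊥ ∨ 2 ∣ p ^ (n - 1) * (p - 1) := by
    rcases hp.eq_two_or_odd' with rfl | hodd
    · rcases h2 rfl with h1 | ⟨x, hx⟩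
      · exact Or.inr (Dvd.dvd.mul_right (dvd_pow_self 2 (by omega)) _)
      · refine Or.inl (le_bot_iff.mp (hle ⊥ (WithBot.bot_lt_coe n) ⟨x, ?_⟩))
        have hξ1 : ξ = -1 := Units.ext (by simpa using hξ.eq_neg_one_of_two_right)
        rw [hξ1, ← hx, unitsIncl_unitsNorm hσ, hG]
        simp [dotSucc]
    · obtain ⟨a, rfl⟩ := hodd
      exact Or.inr (Dvd.dvd.mul_left ⟨a, by omega⟩ _)
  have hmA := exceptional_of_mem_norms hn hmn h90 hpow hμ hζp hζ1 hζσ hpar hmB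
  have hA : IsLeast (exceptionalIndices F K p n) m := by
    refine ⟨(mem_exceptionalIndices_iff hσ hG).mpr ⟨hmn.le, hmA⟩, fun s hs => ?_⟩
    obtain ⟨hsn, hsA⟩ := (mem_exceptionalIndices_iff hσ hG).mp hs
    -- The index n is allowed here but not in the other three sets; it exceeds m anyway.
    rcases hsn.eq_or_lt with rfl | hlt
    · exact hmn.le
    · exact hle s hlt (exists_cycNorm_eq_of_fixed_class hlt hpow hμ hζp hζ1 hζσ
        (exists_fixed_class_of_exceptional hlt hsA))
  have hinv : exceptionalInvariant F K p n = m := hA.csInf_eq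
  rw [hinv]
  refine ⟨hA, ⟨⟨hmn, (hB m hmn).mpr hmB⟩, ?_⟩, ⟨⟨hmn, (hC m hmn).mpr hmC⟩, ?_⟩,
    ⟨⟨hmn, (hD m hmn).mpr (exists_fixed_class_of_exceptional hmn hmA)⟩, ?_⟩⟩
  · rintro s ⟨hs, h⟩
    exact hle s hs (exists_cycNorm_eq_of_mem_norms hs ((hB s hs).mp h))
  · rintro s ⟨hs, h⟩
    exact hle s hs ((hC s hs).mp h)
  · rintro s ⟨hs, h⟩
    exact hle s hs (exists_cycNorm_eq_of_fixed_class hs hpow hμ hζp hζ1 hζσ ((hD s hs).mp h))
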